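/- Notation and definitions. For a set $W$, let $\mathcal F(W)$ denote the set of all finite subsets of $W$, including $\emptyset$. Let $(G,+)$ be a commutative group. A mapping $P:\mathcal F(W)\to G$ is called a polynomial mapping of degree $\le 0$ if it is constant; recursively, for $d\ge 1$, it is called a polynomial mapping of degree $\le d$ if for every $m\in\mathcal F(W)$ there is a polynomial mapping $D_mP:\mathcal F(W\setminus m)\to G$ of degree $\le d-1$ such that $P(n\cup m)=P(n)+(D_mP)(n)$ for every $n\in\mathcal F(W)$ with $n\cap m=\emptyset$. A polynomial mapping is a mapping that is a polynomial mapping of degree $\le d$ for some integer $d\ge 0$. A finite coloring of $G$ is a mapping $\chi:G\to\{1,\dots,r\}$ with $r\in\mathbb N$, and a subset of $G$ is monochromatic if $\chi$ is constant on it. Theorem 8.6. Let $S$ be an infinite set, let $F$ be a finite set, and let $P:\mathcal F(S\times F)\to G$ be a polynomial mapping into a commutative group $G$ with $P(\emptyset)=0$. Then for every finite coloring of $G$ there are $h\in G$ and a nonempty finite set $\gamma\subseteq S$ such that the set $$\{\,h+P(\gamma\times c) : c\subseteq F\,\}$$ is monochromatic. -/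

import Mathlib

/-- For a set `A` of elements of `α`, the finite subsets of `A` are the `n : Finset α` with
`↑n ⊆ A`, and a map from the finite subsets of `A` to `G` is given by a function
`P : Finset α → G` of which only the values at such `n` are ever used.

`PolyDegLE d A P` says that `P`, as a map from the finite subsets of `A` to the commutative
semigroup `G`, is a polynomial mapping of degree `≤ d`:
* for `d = 0`, it is constant;
* for `d + 1`, for each finite `m ⊆ A` there is a polynomial mapping `Q` of degree `≤ d` on the
  finite subsets of `A \ m` such that `P (n ∪ m) = P n + Q n` for all finite `n ⊆ A` disjoint
  from `m` (`Finset.disjUnion` is the union of two disjoint finite sets). -/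
def PolyDegLE {α G : Type*} [AddCommSemigroup G] : ℕ → Set α → (Finset α → G) → Prop
  | 0, A, P => ∃ g : G, ∀ n : Finset α, (n : Set α) ⊆ A → P n = g
  | d + 1, A, P => ∀ m : Finset α, (m : Set α) ⊆ A →
      ∃ Q : Finset α → G, PolyDegLE d (A \ (m : Set α)) Q ∧
        ∀ n : Finset α, (n : Set α) ⊆ A → ∀ hnm : Disjoint n m,
          P (n.disjUnion m hnm) = P n + Q n

/-- A map from the finite subsets of `α` to `G` is a polynomial mapping if it is one of degree
`≤ d` for some `d`. -/
def IsPolynomialMapping {α G : Type*} [AddCommSemigroup G] (P : Finset α → G) : Prop :=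
  ∃ d : ℕ, PolyDegLE d Set.univ P

/-- The subset `M` of `W` is monochromatic for the coloring `χ` if `χ` is constant on `M`. -/
def IsMonochromatic {W κ : Type*} (χ : W → κ) (M : Set W) : Prop :=
  ∀ x ∈ M, ∀ y ∈ M, χ x = χ y

/-! The mappings `γ ↦ P (γ ×ˢ c)` with `c ⊆ F` form a finite family of polynomial mappings vanishing
at `∅` (`comp_product`), so a polynomial van der Waerden theorem for such families suffices. Color
focusing (`exists_focused`) reduces a family to the families of differences `p (n ∪ m) - p m - g n`.
If `g` represents a class of least degree, that class breaks into classes of smaller degree, once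
zero mappings are dropped, and the others keep their degree bounds (`IsClassCover.shifted`). The
multiset of degrees thus drops in the Dershowitz–Manna order. -/

namespace PolyDegLE

variable {α G : Type*}

/-! ### Calculus of polynomial mappings -/

section Semigroup

variable [AddCommSemigroup G]

lemma mono_set {d : ℕ} {A B : Set α} {P : Finset α → G} (h : PolyDegLE d A P) (hBA : B ⊆ A) :
    PolyDegLE d B P := by
  induction d generalizing A B P with
  | zero =>
    obtain ⟨g, hg⟩ := h
    exact ⟨g, fun n hn => hg n (hn.trans hBA)⟩
  | succ d ih =>
    intro m hm
    obtain ⟨Q, hQ, hQP⟩ := h m (hm.trans hBA)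
    exact ⟨Q, ih hQ (Set.sdiff_subset_sdiff_left hBA), fun n hn => hQP n (hn.trans hBA)⟩

lemma congr {d : ℕ} {A : Set α} {P P' : Finset α → G} (h : PolyDegLE d A P)
    (hPP' : ∀ n : Finset α, (n : Set α) ⊆ A → P' n = P n) : PolyDegLE d A P' := by
  cases d with
  | zero =>
    obtain ⟨g, hg⟩ := h
    exact ⟨g, fun n hn => (hPP' n hn).trans (hg n hn)⟩
  | succ d =>
    intro m hm
    obtain ⟨Q, hQ, hQP⟩ := h m hm
    refine ⟨Q, hQ, fun n hn hnm => ?_⟩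
    rw [hPP' n hn, hPP', hQP n hn]
    rw [Finset.coe_disjUnion]
    exact Set.union_subset hn hm

lemma add {d : ℕ} {A : Set α} {P Q : Finset α → G} (hP : PolyDegLE d A P)
    (hQ : PolyDegLE d A Q) : PolyDegLE d A (fun n => P n + Q n) := by
  induction d generalizing A P Q with
  | zero =>
    obtain ⟨g, hg⟩ := hP
    obtain ⟨g', hg'⟩ := hQ
    exact ⟨g + g', fun n hn => by simp only [hg n hn, hg' n hn]⟩
  | succ d ih =>
    intro m hm
    obtain ⟨P', hP', hPP⟩ := hP m hm
    obtain ⟨Q', hQ', hQQ⟩ := hQ m hm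
    refine ⟨_, ih hP' hQ', fun n hn hnm => ?_⟩
    simp only [hPP n hn hnm, hQQ n hn hnm]
    exact add_add_add_comm _ _ _ _

/-- Restricting a polynomial mapping on `S × F` to products `γ × c` with `c` fixed gives a
polynomial mapping of `γ`. -/
lemma comp_product {S F : Type*} {d : ℕ} {A : Set (S × F)} {P : Finset (S × F) → G}
    (hP : PolyDegLE d A P) (c : Finset F) {B : Set S} (hB : B ×ˢ (c : Set F) ⊆ A) :
    PolyDegLE d B (fun γ => P (γ ×ˢ c)) := by
  induction d generalizing A B P with
  | zero =>
    obtain ⟨g, hg⟩ := hP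
    refine ⟨g, fun n hn => hg _ ?_⟩
    rw [Finset.coe_product]
    exact (Set.prod_mono_left hn).trans hB
  | succ d ih =>
    intro m hm
    have key : ∀ n : Finset S, (n : Set S) ⊆ B → ((n ×ˢ c : Finset (S × F)) : Set (S × F)) ⊆ A :=
      fun n hn => by
        rw [Finset.coe_product]
        exact (Set.prod_mono_left hn).trans hB
    obtain ⟨Q, hQ, hPQ⟩ := hP (m ×ˢ c) (key m hm)
    refine ⟨_, ih hQ (B := B \ m) ?_, fun n hn hnm => ?_⟩
    · rintro ⟨s, f⟩ ⟨⟨hs, hsm⟩, hf⟩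
      exact ⟨hB ⟨hs, hf⟩, fun h => hsm (by simpa using (Finset.mem_product.1 h).1)⟩
    · rw [← hPQ _ (key n hn) (Finset.disjoint_product.2 (Or.inl hnm))]
      refine congrArg P (Finset.ext fun ⟨s, f⟩ => ?_)
      simp only [Finset.mem_product, Finset.mem_disjUnion]
      tauto

end Semigroup

section Group

variable [AddCommGroup G]

lemma const (d : ℕ) (A : Set α) (g : G) : PolyDegLE d A (fun _ => g) := by
  induction d generalizing A g with
  | zero => exact ⟨g, fun _ _ => rfl⟩
  | succ d ih => exact fun m _ => ⟨fun _ => 0, ih _ 0, fun _ _ _ => (add_zero g).symm⟩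

lemma neg {d : ℕ} {A : Set α} {P : Finset α → G} (hP : PolyDegLE d A P) :
    PolyDegLE d A (fun n => -P n) := by
  induction d generalizing A P with
  | zero =>
    obtain ⟨g, hg⟩ := hP
    exact ⟨-g, fun n hn => by simp only [hg n hn]⟩
  | succ d ih =>
    intro m hm
    obtain ⟨P', hP', hPP⟩ := hP m hm
    refine ⟨_, ih hP', fun n hn hnm => ?_⟩
    simp only [hPP n hn hnm]
    exact neg_add _ _

lemma sub {d : ℕ} {A : Set α} {P Q : Finset α → G} (hP : PolyDegLE d A P)
    (hQ : PolyDegLE d A Q) : PolyDegLE d A (fun n => P n - Q n) := by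
  simpa only [sub_eq_add_neg] using hP.add hQ.neg

lemma succ {d : ℕ} {A : Set α} {P : Finset α → G} (hP : PolyDegLE d A P) :
    PolyDegLE (d + 1) A P := by
  induction d generalizing A P with
  | zero =>
    obtain ⟨g, hg⟩ := hP
    exact congr (const 1 A g) hg
  | succ d ih =>
    intro m hm
    obtain ⟨Q, hQ, h⟩ := hP m hm
    exact ⟨Q, ih hQ, h⟩

lemma mono_deg {d e : ℕ} (hde : d ≤ e) {A : Set α} {P : Finset α → G}
    (hP : PolyDegLE d A P) : PolyDegLE e A P := by
  induction e, hde using Nat.le_induction with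
  | base => exact hP
  | succ e _ ih => exact ih.succ

/-- Differencing at `m` lowers the degree by one. -/
lemma diff [DecidableEq α] {d : ℕ} {A B : Set α} {P : Finset α → G}
    (hP : PolyDegLE (d + 1) A P) {m : Finset α} (hm : (m : Set α) ⊆ A) (hB : B ⊆ A \ m) :
    PolyDegLE d B (fun n => P (n ∪ m) - P n) := by
  obtain ⟨Q, hQ, h⟩ := hP m hm
  refine congr (hQ.mono_set hB) fun n hn => ?_
  have hnm : Disjoint n m :=
    Finset.disjoint_left.2 fun x hx hxm => (hB (hn hx)).2 hxm
  have := h n (hn.trans (hB.trans Set.sdiff_subset)) hnm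
  rw [Finset.disjUnion_eq_union] at this
  rw [this, add_sub_cancel_left]

lemma eq_zero_of_zero {A : Set α} {P : Finset α → G} (hP : PolyDegLE 0 A P) (h0 : P ∅ = 0)
    {n : Finset α} (hn : (n : Set α) ⊆ A) : P n = 0 := by
  obtain ⟨g, hg⟩ := hP
  rw [hg n hn, ← hg ∅ (by simp), h0]

end Group

end PolyDegLE

universe u v

/-! ### Recurrent families and class covers -/

section Recurrence

variable {S : Type v} {G : Type u} [AddCommGroup G]

/-- A family `A` of mappings from the finite subsets of `B` to `G` is recurrent if for each finite
set of colors there are finitely many `γ` and `h` among which, for every coloring of `G`, one can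
find `γ ≠ ∅` and `h` such that all `h + p γ` have the color of `h`. -/
def IsRecurrentFamily (B : Set S) (A : Finset (Finset S → G)) : Prop :=
  ∀ (κ : Type u) [Finite κ], ∃ N : Finset S, (N : Set S) ⊆ B ∧ ∃ X : Finset G,
    ∀ χ : G → κ, ∃ h ∈ X, ∃ γ ⊆ N, γ.Nonempty ∧ ∀ p ∈ A, χ (h + p γ) = χ h

/-- The family `A` is covered by classes `(e, g) ∈ L`, with `g` of degree `≤ e + 1`, modulo
mappings of degree `≤ e`. -/
structure IsClassCover (B : Set S) (A : Finset (Finset S → G))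
    (L : Multiset (ℕ × (Finset S → G))) : Prop where
  rep_deg : ∀ c ∈ L, PolyDegLE (c.1 + 1) B c.2
  rep_zero : ∀ c ∈ L, c.2 ∅ = 0
  map_zero : ∀ p ∈ A, p ∅ = 0
  exists_rep : ∀ p ∈ A, ∃ c ∈ L, PolyDegLE c.1 B (fun n => p n - c.2 n)

/-- A mapping that vanishes on `B` only asks that `h` have its own color, so it can be dropped
before the induction hypothesis is used. -/
lemma IsRecurrentFamily.of_eq_zero {B : Set S} {A A' : Finset (Finset S → G)}
    (h : IsRecurrentFamily B A')
    (hA : ∀ p ∈ A, p ∈ A' ∨ ∀ n : Finset S, (n : Set S) ⊆ B → p n = 0) :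
    IsRecurrentFamily B A := by
  intro κ _
  obtain ⟨N, hN, X, hX⟩ := h κ
  refine ⟨N, hN, X, fun χ => ?_⟩
  obtain ⟨a, ha, γ, hγN, hγ, H⟩ := hX χ
  refine ⟨a, ha, γ, hγN, hγ, fun p hp => ?_⟩
  rcases hA p hp with hp | hp
  · exact H p hp
  · rw [hp γ ((Finset.coe_subset.2 hγN).trans hN), add_zero]

lemma isRecurrentFamily_empty {B : Set S} (hB : B.Nonempty) :
    IsRecurrentFamily B (∅ : Finset (Finset S → G)) := by
  intro κ _
  obtain ⟨s, hs⟩ := hB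
  exact ⟨{s}, by simpa using hs, {0}, fun χ => ⟨0, by simp, {s}, subset_rfl, by simp, by simp⟩⟩

/-! ### Color focusing -/

open Classical in
/-- The family obtained from `A` by the shifts `m ⊆ N` followed by subtraction of `g`. -/
noncomputable def shiftedFamily (A : Finset (Finset S → G)) (g : Finset S → G) (N : Finset S) :
    Finset (Finset S → G) :=
  (A ×ˢ N.powerset).image fun x n => x.1 (n ∪ x.2) - x.1 x.2 - g n

lemma mem_shiftedFamily [DecidableEq S] {A : Finset (Finset S → G)} {g : Finset S → G}
    {N : Finset S} {q : Finset S → G} :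
    q ∈ shiftedFamily A g N ↔
      ∃ p ∈ A, ∃ m ⊆ N, q = fun n => p (n ∪ m) - p m - g n := by
  classical
  simp only [shiftedFamily, Finset.mem_image, Finset.mem_product, Finset.mem_powerset]
  constructor
  · rintro ⟨⟨p, m⟩, ⟨hp, hm⟩, rfl⟩
    refine ⟨p, hp, m, hm, ?_⟩
    funext n
    congr!
  · rintro ⟨p, hp, m, hm, rfl⟩
    refine ⟨⟨p, m⟩, ⟨hp, hm⟩, ?_⟩
    funext n
    congr!

open Classical in
/-- Color focusing: either a monochromatic configuration exists, or there are `k` configurations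
of pairwise distinct colors that are focused at a common point. -/
lemma exists_focused {B : Set S} {A : Finset (Finset S → G)} {g : Finset S → G}
    (hA : ∀ p ∈ A, p ∅ = 0)
    (hrec : ∀ N : Finset S, (N : Set S) ⊆ B → IsRecurrentFamily (B \ N) (shiftedFamily A g N))
    (κ : Type u) [Finite κ] (k : ℕ) :
    ∃ N : Finset S, (N : Set S) ⊆ B ∧ ∃ X : Finset G, ∀ χ : G → κ,
      (∃ h ∈ X, ∃ γ ⊆ N, γ.Nonempty ∧ ∀ p ∈ A, χ (h + p γ) = χ h) ∨
      ∃ a ∈ X, ∃ T : Finset κ, T.card = k ∧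
        ∀ c ∈ T, ∃ γ ⊆ N, γ.Nonempty ∧ ∀ p ∈ A, χ (a + p γ) = c := by
  induction k with
  | zero => exact ⟨∅, by simp, {0}, fun χ => Or.inr ⟨0, by simp, ∅, rfl, by simp⟩⟩
  | succ k ih =>
    obtain ⟨N₀, hN₀, X₀, h₀⟩ := ih
    -- Coloring by `Y → κ` below controls all translates by `Y` at once. `Y` depends only on `X₀`
    -- and `N₀`, which is why these must be uniform in `χ`.
    let Y : Finset G := X₀ ∪ (X₀ ×ˢ A ×ˢ N₀.powerset).image fun x => x.1 + x.2.1 x.2.2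
    have hY : ∀ a ∈ X₀, ∀ p ∈ A, ∀ m ⊆ N₀, a + p m ∈ Y := fun a ha p hp m hm =>
      Finset.mem_union_right _ (Finset.mem_image.2
        ⟨(a, p, m), by simp [ha, hp, hm], rfl⟩)
    obtain ⟨N₁, hN₁, X₁, h₁⟩ := hrec N₀ hN₀ (Y → κ)
    refine ⟨N₀ ∪ N₁, ?_,
      (X₁ ×ˢ X₀).image (fun x => x.1 + x.2) ∪
        (X₁ ×ˢ N₁.powerset ×ˢ X₀).image (fun x => x.1 - g x.2.1 + x.2.2), fun χ => ?_⟩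
    · rw [Finset.coe_union]
      exact Set.union_subset hN₀ (hN₁.trans Set.sdiff_subset)
    obtain ⟨h, hh, γ, hγN, hγ, H⟩ := h₁ fun x y => χ (x + y)
    have H' : ∀ p ∈ A, ∀ m ⊆ N₀, ∀ y ∈ Y,
        χ (h + (p (γ ∪ m) - p m - g γ) + y) = χ (h + y) := fun p hp m hm y hy =>
      congrFun (H _ (mem_shiftedFamily.2 ⟨p, hp, m, hm, rfl⟩)) ⟨y, hy⟩
    have left : ∀ a ∈ X₀, ∀ m ⊆ N₀, m.Nonempty →
        (∀ p ∈ A, χ (h + (a + p m)) = χ (h + a)) →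
        ∃ h' ∈ (X₁ ×ˢ X₀).image (fun x => x.1 + x.2) ∪
          (X₁ ×ˢ N₁.powerset ×ˢ X₀).image (fun x => x.1 - g x.2.1 + x.2.2),
          ∃ γ ⊆ N₀ ∪ N₁, γ.Nonempty ∧ ∀ p ∈ A, χ (h' + p γ) = χ h' := by
      intro a ha m hm hmne hp
      refine ⟨h + a, Finset.mem_union_left _ (Finset.mem_image.2 ⟨(h, a), by simp [hh, ha], rfl⟩),
        m, hm.trans Finset.subset_union_left, hmne, fun p hpA => ?_⟩
      rw [add_assoc, hp p hpA]
    rcases h₀ fun x => χ (h + x) with ⟨a, ha, m, hm, hmne, hp⟩ | ⟨a, ha, T, hT, hf⟩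
    · exact Or.inl (left a ha m hm hmne hp)
    by_cases hc : χ (h + a) ∈ T
    · obtain ⟨m, hm, hmne, hp⟩ := hf _ hc
      exact Or.inl (left a ha m hm hmne hp)
    -- At the new focus, `h - g γ + a + p (γ ∪ m)` equals `h + (p (γ ∪ m) - p m - g γ) + (a + p m)`,
    -- so it has the old color of `h + (a + p m)`. Taking `m = ∅` gives the new color `χ (h + a)`.
    refine Or.inr ⟨h - g γ + a, Finset.mem_union_right _ (Finset.mem_image.2
      ⟨(h, γ, a), by simp [hh, ha, hγN], rfl⟩), insert (χ (h + a)) T,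
      by rw [Finset.card_insert_of_notMem hc, hT], fun c hcT => ?_⟩
    rcases Finset.mem_insert.1 hcT with rfl | hcT
    · refine ⟨γ, hγN.trans Finset.subset_union_right, hγ, fun p hp => ?_⟩
      rw [← H' p hp ∅ (Finset.empty_subset _) a (Finset.mem_union_left _ ha), hA p hp,
        Finset.union_empty]
      congr 1
      abel
    · obtain ⟨m, hm, -, hp⟩ := hf c hcT
      refine ⟨γ ∪ m, Finset.union_subset (hγN.trans Finset.subset_union_right)
        (hm.trans Finset.subset_union_left), hγ.mono Finset.subset_union_left, fun p hpA => ?_⟩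
      rw [← hp p hpA, ← H' p hpA m hm _ (hY a ha p hpA m hm)]
      congr 1
      abel

/-- With as many focused configurations as colors, one of them has the color of the focus itself. -/
lemma isRecurrentFamily_of_shifted {B : Set S} {A : Finset (Finset S → G)} {g : Finset S → G}
    (hA : ∀ p ∈ A, p ∅ = 0)
    (hrec : ∀ N : Finset S, (N : Set S) ⊆ B → IsRecurrentFamily (B \ N) (shiftedFamily A g N)) :
    IsRecurrentFamily B A := by
  intro κ _
  have := Fintype.ofFinite κ
  obtain ⟨N, hN, X, hX⟩ := exists_focused hA hrec κ (Fintype.card κ)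
  refine ⟨N, hN, X, fun χ => ?_⟩
  rcases hX χ with h | ⟨a, ha, T, hT, hf⟩
  · exact h
  · obtain ⟨γ, hγN, hγ, h⟩ := hf (χ a) (by rw [Finset.card_eq_iff_eq_univ T |>.1 hT]; simp)
    exact ⟨a, ha, γ, hγN, hγ, h⟩

/-! ### Induction on the multiset of degrees -/

open Classical in
/-- Shifting by `m ⊆ N` and subtracting the representative `g` of a class of minimal degree `e`
replaces that class by finitely many classes of smaller degree. -/
lemma IsClassCover.shifted {B : Set S} {A : Finset (Finset S → G)} {e : ℕ} {g : Finset S → G}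
    {L : Multiset (ℕ × (Finset S → G))} (h : IsClassCover B A ((e, g) ::ₘ L))
    (hmin : ∀ c ∈ L, e ≤ c.1) {N : Finset S} (hN : (N : Set S) ⊆ B)
    {A' : Finset (Finset S → G)} (hA' : A' ⊆ shiftedFamily A g N) :
    IsClassCover (B \ N) A' ((L.map fun c => (c.1, fun n => c.2 n - g n)) +
      (A'.filter (PolyDegLE e (B \ N))).val.map fun q => (e - 1, q)) := by
  have hg0 : g ∅ = 0 := h.rep_zero (e, g) (Multiset.mem_cons_self _ _)
  have hg : PolyDegLE (e + 1) (B \ N) g :=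
    (h.rep_deg (e, g) (Multiset.mem_cons_self _ _)).mono_set Set.sdiff_subset
  have hzero : ∀ q ∈ A', q ∅ = 0 := fun q hq => by
    obtain ⟨p, -, m, -, rfl⟩ := mem_shiftedFamily.1 (hA' hq)
    simp [hg0]
  constructor
  · intro c hc
    rcases Multiset.mem_add.1 hc with hc | hc
    · obtain ⟨c, hcL, rfl⟩ := Multiset.mem_map.1 hc
      exact ((h.rep_deg c (Multiset.mem_cons_of_mem hcL)).mono_set Set.sdiff_subset).sub
        (hg.mono_deg (Nat.succ_le_succ (hmin c hcL)))
    · obtain ⟨q, hq, rfl⟩ := Multiset.mem_map.1 hc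
      -- Truncated subtraction is harmless: `e ≤ e - 1 + 1` also for `e = 0`.
      exact (Finset.mem_filter.1 hq).2.mono_deg (by simp only; omega)
  · intro c hc
    rcases Multiset.mem_add.1 hc with hc | hc
    · obtain ⟨c, hcL, rfl⟩ := Multiset.mem_map.1 hc
      simp only [h.rep_zero c (Multiset.mem_cons_of_mem hcL), hg0, sub_zero]
    · obtain ⟨q, hq, rfl⟩ := Multiset.mem_map.1 hc
      exact hzero q (Finset.mem_filter.1 hq).1
  · exact hzero
  · intro q hq
    obtain ⟨p, hp, m, hm, hqp⟩ := mem_shiftedFamily.1 (hA' hq)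
    obtain ⟨c, hc, hpc⟩ := h.exists_rep p hp
    have hec : e ≤ c.1 := by
      rcases Multiset.mem_cons.1 hc with rfl | hc
      · exact le_rfl
      · exact hmin c hc
    have hp' : PolyDegLE (c.1 + 1) B p := by
      refine (hpc.succ.add (h.rep_deg c hc)).congr fun n _ => ?_
      simp
    have hmN : (m : Set S) ⊆ N := Finset.coe_subset.2 hm
    have hd : PolyDegLE c.1 (B \ N) fun n => q n - (c.2 n - g n) := by
      refine (((hpc.mono_set Set.sdiff_subset).add (hp'.diff (hmN.trans hN)
        (Set.sdiff_subset_sdiff_right hmN))).sub (PolyDegLE.const _ _ (p m))).congr fun n _ => ?_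
      simp only [hqp]
      abel
    rcases Multiset.mem_cons.1 hc with rfl | hc
    · refine ⟨(e - 1, q), Multiset.mem_add.2 (Or.inr (Multiset.mem_map.2 ⟨q, ?_, rfl⟩)), ?_⟩
      · exact Finset.mem_filter.2 ⟨hq, by simpa using hd⟩
      · simpa using PolyDegLE.const (e - 1) (B \ N) (0 : G)
    · exact ⟨_, Multiset.mem_add.2 (Or.inl (Multiset.mem_map.2 ⟨c, hc, rfl⟩)), hd⟩

/-- The polynomial van der Waerden theorem for finite families of polynomial mappings on the
finite subsets of an infinite set, in terms of a class cover. -/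
lemma IsClassCover.isRecurrentFamily {B : Set S} (hB : B.Infinite)
    {A : Finset (Finset S → G)} {L : Multiset (ℕ × (Finset S → G))} (h : IsClassCover B A L) :
    IsRecurrentFamily B A := by
  classical
  induction L using (InvImage.wf (Multiset.map Prod.fst)
    (Multiset.wellFounded_isDershowitzMannaLT (α := ℕ))).induction generalizing B A with
  | _ L ih =>
  rcases L.empty_or_exists_mem with rfl | hL
  · have : A = ∅ := Finset.eq_empty_of_forall_notMem fun p hp => by
      simpa using h.exists_rep p hp
    exact this ▸ isRecurrentFamily_empty hB.nonempty
  obtain ⟨⟨e, g⟩, hc, hmin⟩ := L.toFinset.exists_min_image Prod.fst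
    (by simpa [Finset.Nonempty] using hL)
  obtain ⟨L, rfl⟩ := Multiset.exists_cons_of_mem (Multiset.mem_toFinset.1 hc)
  refine isRecurrentFamily_of_shifted (g := g) h.map_zero fun N hN => ?_
  let A' := (shiftedFamily A g N).filter fun q =>
    ¬ ∀ n : Finset S, (n : Set S) ⊆ B \ N → q n = 0
  have hcover := h.shifted (fun c hc => hmin c (Multiset.mem_toFinset.2
    (Multiset.mem_cons_of_mem hc))) hN (A' := A') (Finset.filter_subset _ _)
  refine (ih _ ?_ (hB.sdiff N.finite_toSet) hcover).of_eq_zero fun q hq => ?_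
  · refine ⟨L.map Prod.fst, (A'.filter (PolyDegLE e (B \ N))).val.map fun _ => e - 1, {e},
      by simp, by simp [Multiset.map_map], ?_, fun y hy => ⟨e, by simp, ?_⟩⟩
    · rw [Multiset.map_cons, ← Multiset.singleton_add, add_comm]
    · obtain ⟨q, hq, rfl⟩ := Multiset.mem_map.1 hy
      obtain ⟨hqA, hqe⟩ := Finset.mem_filter.1 hq
      -- For `e = 0`, `q` would be constant with value `q ∅ = 0`, but `A'` excludes zero mappings.
      suffices e ≠ 0 by omega
      rintro rfl
      exact (Finset.mem_filter.1 hqA).2 fun n hn =>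
        hqe.eq_zero_of_zero (hcover.map_zero q hqA) hn
  · by_cases hz : ∀ n : Finset S, (n : Set S) ⊆ B \ N → q n = 0
    · exact Or.inr hz
    · exact Or.inl (Finset.mem_filter.2 ⟨hq, hz⟩)

/-- Each mapping serves as its own class. -/
lemma isRecurrentFamily_of_polyDegLE {B : Set S} (hB : B.Infinite) {A : Finset (Finset S → G)}
    {d : ℕ} (hA : ∀ p ∈ A, PolyDegLE d B p) (hA0 : ∀ p ∈ A, p ∅ = 0) :
    IsRecurrentFamily B A := by
  refine IsClassCover.isRecurrentFamily hB (L := A.val.map fun p => (d, p)) ⟨?_, ?_, hA0, ?_⟩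
  · intro c hc
    obtain ⟨p, hp, rfl⟩ := Multiset.mem_map.1 hc
    exact (hA p hp).succ
  · intro c hc
    obtain ⟨p, hp, rfl⟩ := Multiset.mem_map.1 hc
    exact hA0 p hp
  · intro p hp
    exact ⟨(d, p), Multiset.mem_map.2 ⟨p, hp, rfl⟩, by
      simpa using PolyDegLE.const d B (0 : G)⟩

end Recurrence

theorem theorem8p6 {S F G : Type*} [Infinite S] [Finite F] [AddCommGroup G]
    (P : Finset (S × F) → G) (hP : IsPolynomialMapping P) (hP0 : P ∅ = 0)
    (r : ℕ) (χ : G → Fin r) :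
    ∃ (h : G) (γ : Finset S), γ.Nonempty ∧
      IsMonochromatic χ {x : G | ∃ c : Finset F, x = h + P (γ ×ˢ c)} := by
  classical
  have := Fintype.ofFinite F
  obtain ⟨d, hd⟩ := hP
  have hrec : IsRecurrentFamily (Set.univ : Set S)
      ((Finset.univ : Finset (Finset F)).image fun c γ => P (γ ×ˢ c)) := by
    refine isRecurrentFamily_of_polyDegLE Set.infinite_univ (d := d) ?_ ?_
    · intro p hp
      obtain ⟨c, -, rfl⟩ := Finset.mem_image.1 hp
      exact hd.comp_product c (Set.subset_univ _)
    · intro p hp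
      obtain ⟨c, -, rfl⟩ := Finset.mem_image.1 hp
      simpa using hP0
  -- Colors live in the universe of `G`, so that `Y → κ` is again allowed as a set of colors.
  obtain ⟨N, -, X, hX⟩ := hrec (ULift (Fin r))
  obtain ⟨h, -, γ, -, hγ, H⟩ := hX fun x => ⟨χ x⟩
  have H' : ∀ c : Finset F, χ (h + P (γ ×ˢ c)) = χ h := fun c =>
    congrArg ULift.down (H _ (Finset.mem_image_of_mem _ (Finset.mem_univ c)))
  refine ⟨h, γ, hγ, ?_⟩
  rintro _ ⟨c, rfl⟩ _ ⟨c', rfl⟩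
  rw [H', H']
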